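/- Let $n$ be a natural number and let $K\subsetneq 2^{[n]}$ be a proper simplicial complex (a family of subsets of $[n]$ closed under taking subsets, with $\emptyset\in K$) such that $\{i\}\in K$ for every $i\in[n]$. Let $K^\circ=\{A\subseteq[n] : [n]\setminus A\notin K\}$ be its Alexander dual. Let $H_0=\{x\in\mathbb{R}^n : x_1+\dots+x_n=0\}$ with the Euclidean inner product, and $\delta_i=e_i-\frac1n(e_1+\dots+e_n)\in H_0$. The canonical fan $\mathrm{Fan}(K)$ is the collection of all convex cones in $H_0$ generated by $\{\delta_i : i\in A_1\}\cup\{-\delta_j : j\in A_2\}$, where $A_1\in K$, $A_2\in K^\circ$ and $A_1\cap A_2=\emptyset$. Then the following are equivalent: (a) $K$ is a threshold complex, i.e. there are weights $w_1,\dots,w_n>0$ and a quota $q>0$ such that $K=\{A\subseteq[n] : \sum_{i\in A}w_i<q\}$; (b) $\Gamma=2^{[n]}\setminus K$ is a weighted majority game with strictly positive weights, i.e. $\Gamma$ is a simple game (closed under supersets, $[n]\in\Gamma$, $\emptyset\notin\Gamma$) and there are $w_1,\dots,w_n>0$ and $q\in\mathbb{R}$ such that, for all $A\subseteq[n]$,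 $A\in\Gamma$ if and only if $\sum_{i\in A}w_i\ge q$; (c) $\mathrm{Fan}(K)$ is polytopal, i.e. there is a nonempty convex polytope $Q\subset H_0$ whose normal fan, the collection of the cones $\{u\in H_0 : \langle u,y\rangle\le\langle u,x\rangle \text{ for all } x\in F,\ y\in Q\}$ over all nonempty faces $F$ of $Q$, equals $\mathrm{Fan}(K)$. -/

import Mathlib

/-! ### Simplicial complexes and simple games on `Fin n` -/

/-- A simplicial complex `K ⊆ 2^[n]`: a down-set containing the empty set. -/
structure IsSimplicialComplex {n : ℕ} (K : Set (Finset (Fin n))) : Prop where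
  empty_mem : ∅ ∈ K
  isLowerSet : IsLowerSet K

/-- The vertex set of `K`, i.e. the elements that are not ghost vertices. -/
def vertexSet {n : ℕ} (K : Set (Finset (Fin n))) : Set (Fin n) :=
  {i | {i} ∈ K}

/-- A simple game: an up-set of coalitions in which the grand coalition wins and the empty
coalition loses. -/
structure IsSimpleGame {n : ℕ} (Γ : Set (Finset (Fin n))) : Prop where
  univ_mem : Finset.univ ∈ Γ
  empty_notMem : ∅ ∉ Γ
  isUpperSet : IsUpperSet Γ

/-- `K = {A | w(A) < q}` for some strictly positive weights `w` and some quota `q > 0`. -/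
def IsThresholdComplex {n : ℕ} (K : Set (Finset (Fin n))) : Prop :=
  ∃ (w : Fin n → ℝ) (q : ℝ), (∀ i, 0 < w i) ∧ 0 < q ∧ K = {A | ∑ i ∈ A, w i < q}

/-- A weighted majority game with strictly positive weights: a simple game whose winning
coalitions are those whose total weight reaches a prescribed quota. -/
def IsPositivelyWeightedMajorityGame {n : ℕ} (Γ : Set (Finset (Fin n))) : Prop :=
  IsSimpleGame Γ ∧
    ∃ (w : Fin n → ℝ) (q : ℝ), (∀ i, 0 < w i) ∧ ∀ A, A ∈ Γ ↔ q ≤ ∑ i ∈ A, w i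

/-- The Alexander dual `K° = {A | [n] \ A ∉ K}`. -/
def alexanderDual {n : ℕ} (K : Set (Finset (Fin n))) : Set (Finset (Fin n)) :=
  {A | Aᶜ ∉ K}

/-- The Bier sphere, i.e. the deleted join of `K` and its Alexander dual. The pair `(A₁, A₂)`
stands for the simplex `A₁ ∪ {j̄ | j ∈ A₂}`. -/
def bierSphere {n : ℕ} (K : Set (Finset (Fin n))) : Set (Finset (Fin n) × Finset (Fin n)) :=
  {τ | τ.1 ∈ K ∧ τ.2 ∈ alexanderDual K ∧ Disjoint τ.1 τ.2}

/-! ### The canonical fan -/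

/-- The hyperplane `H₀ = {x ∈ ℝⁿ | x₁ + ⋯ + xₙ = 0}` with the Euclidean inner product. -/
def hyperplaneZero (n : ℕ) : Submodule ℝ (EuclideanSpace ℝ (Fin n)) where
  carrier := {x | ∑ i, x i = 0}
  zero_mem' := by simp
  add_mem' := by
    intro a b ha hb
    simp only [Set.mem_ofPred_eq] at ha hb ⊢
    simp [Finset.sum_add_distrib, ha, hb]
  smul_mem' := by
    intro c a ha
    simp only [Set.mem_ofPred_eq] at ha ⊢
    simp [← Finset.mul_sum, ha]

/-- `δᵢ = eᵢ - (1/n)(e₁ + ⋯ + eₙ)`, as a vector of `H₀`. -/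
noncomputable def canonicalRay {n : ℕ} (i : Fin n) : hyperplaneZero n :=
  ⟨EuclideanSpace.single i (1 : ℝ) - (n : ℝ)⁻¹ • ∑ j, EuclideanSpace.single j (1 : ℝ), by
    have hn : (n : ℝ) ≠ 0 := Nat.cast_ne_zero.mpr (Fin.pos i).ne'
    change ∑ k, _ = (0 : ℝ)
    simp [Finset.sum_sub_distrib, Pi.single_apply, hn]⟩

/-- The convex cone generated by `δᵢ`, `i ∈ A₁`, and `-δⱼ`, `j ∈ A₂`. -/
noncomputable def simplexCone {n : ℕ} (A₁ A₂ : Finset (Fin n)) : Set (hyperplaneZero n) :=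
  (PointedCone.hull ℝ
    ((fun i => canonicalRay i) '' (A₁ : Set (Fin n)) ∪
      (fun j => -canonicalRay j) '' (A₂ : Set (Fin n))) : PointedCone ℝ (hyperplaneZero n))

/-- The canonical fan of `K`: the cones spanned by the simplices of the Bier sphere. -/
noncomputable def canonicalFan {n : ℕ} (K : Set (Finset (Fin n))) :
    Set (Set (hyperplaneZero n)) :=
  {C | ∃ τ ∈ bierSphere K, C = simplexCone τ.1 τ.2}

/-! ### Normal fans of polytopes -/

section NormalFan

variable {V : Type*} [NormedAddCommGroup V] [InnerProductSpace ℝ V]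

/-- A (nonempty) convex polytope: the convex hull of a nonempty finite set. -/
def IsConvexPolytope (Q : Set V) : Prop :=
  ∃ s : Set V, s.Finite ∧ s.Nonempty ∧ Q = convexHull ℝ s

/-- The (outer) normal cone of `Q` at `F ⊆ Q`: all `u` such that the functional `⟨u, ·⟩` attains
its maximum over `Q` at every point of `F`. -/
def normalCone (Q F : Set V) : Set V :=
  {u | ∀ x ∈ F, ∀ y ∈ Q, inner ℝ u y ≤ inner ℝ u x}

/-- The normal fan of `Q`: the normal cones of all nonempty (exposed) faces of `Q`, including
`Q` itself. -/
def normalFan (Q : Set V) : Set (Set V) :=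
  {C | ∃ F, IsExposed ℝ Q F ∧ F.Nonempty ∧ C = normalCone Q F}

/-- A collection of cones is polytopal if it is the normal fan of a convex polytope. -/
def IsPolytopalFan (𝓕 : Set (Set V)) : Prop :=
  ∃ Q : Set V, IsConvexPolytope Q ∧ 𝓕 = normalFan Q

end NormalFan

/-! ### Coordinates on `H₀` -/

/-! From fan to weights: the support function `p` of `Q` is sublinear on `H₀` and linear on each
cone of the normal fan. As the `δᵢ` sum to zero, `∑_{i ∈ A} δᵢ = ∑_{i ∉ A} -δᵢ`. If `A ∈ K`,
linearity on the cone of `(A, ∅)` gives `∑_{i ∈ A} p(δᵢ) ≤ ∑_{i ∉ A} p(-δᵢ)`; if `A ∉ K`, linearity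
on the cone of `(∅, Aᶜ)` gives the reverse. Rearranged, this compares `w(A)` with `q`, where `wᵢ =
p(δᵢ) + p(-δᵢ)` is a width of `Q` and `q = ∑ p(-δᵢ)`, up to a correction where `{i} ∉ K°`.

From weights to fan: cut by `H₀` a box with side lengths `wᵢ`, placed so that its vertex with upper
bounds on `A` has coordinate sum `w(A) - q`. For generic `q` no vertex lies on `H₀`. The normal cone
at `y` is generated by `δᵢ` for the upper bounds attained and `-δⱼ` for the lower ones
(`normalCone_singleton_boxSection`). The pairs of attained bounds are exactly the simplices of the
Bier sphere (`exists_contactSet_eq`, `sum_contactSet_nonpos`, `sum_compl_contactSet_nonneg`).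

The equivalence with majority games is complementation. -/

lemma sum_coe_eq_zero {n : ℕ} (u : hyperplaneZero n) : ∑ i, (u : EuclideanSpace ℝ (Fin n)) i = 0 :=
  u.2

lemma canonicalRay_apply {n : ℕ} (i j : Fin n) :
    (canonicalRay i : EuclideanSpace ℝ (Fin n)) j = (if j = i then 1 else 0) - (n : ℝ)⁻¹ := by
  simp [canonicalRay, Pi.single_apply]

lemma inner_eq_sum {n : ℕ} (u x : hyperplaneZero n) :
    inner ℝ u x = ∑ i, (u : EuclideanSpace ℝ (Fin n)) i * (x : EuclideanSpace ℝ (Fin n)) i := by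
  rw [Submodule.coe_inner, PiLp.inner_apply]
  exact Finset.sum_congr rfl fun i _ => by simp [mul_comm]

lemma inner_canonicalRay {n : ℕ} (i : Fin n) (x : hyperplaneZero n) :
    inner ℝ (canonicalRay i) x = (x : EuclideanSpace ℝ (Fin n)) i := by
  rw [inner_eq_sum]
  simp [canonicalRay_apply, sub_mul, Finset.sum_sub_distrib, ← Finset.mul_sum, sum_coe_eq_zero]

lemma inner_smul_left_hyperplaneZero {n : ℕ} (a : ℝ) (u x : hyperplaneZero n) :
    inner ℝ (a • u) x = a * inner ℝ u x :=
  real_inner_smul_left u x a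

lemma inner_smul_right_hyperplaneZero {n : ℕ} (a : ℝ) (u x : hyperplaneZero n) :
    inner ℝ u (a • x) = a * inner ℝ u x :=
  real_inner_smul_right u x a

/-- The `δᵢ` sum to zero, so the shift `t` is free; it becomes the level `t` of
`mem_simplexCone_iff`. -/
lemma sum_smul_canonicalRay {n : ℕ} (u : hyperplaneZero n) (t : ℝ) :
    ∑ i, ((u : EuclideanSpace ℝ (Fin n)) i - t) • canonicalRay i = u := by
  refine ext_inner_right ℝ fun x => ?_
  rw [sum_inner, inner_eq_sum]
  simp only [inner_smul_left_hyperplaneZero, inner_canonicalRay, sub_mul, Finset.sum_sub_distrib,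
    ← Finset.mul_sum, sum_coe_eq_zero, mul_zero, sub_zero]

lemma sum_canonicalRay_eq_sum_compl {n : ℕ} (A : Finset (Fin n)) :
    ∑ i ∈ A, canonicalRay i = ∑ i ∈ Aᶜ, -canonicalRay i := by
  refine ext_inner_right ℝ fun x => ?_
  have h := Finset.sum_add_sum_compl A fun i => (x : EuclideanSpace ℝ (Fin n)) i
  rw [sum_coe_eq_zero] at h
  simp only [sum_inner, inner_neg_left, inner_canonicalRay, Finset.sum_neg_distrib]
  linarith

/-! ### The cones of the canonical fan -/

lemma canonicalRay_mem_simplexCone {n : ℕ} {A₁ A₂ : Finset (Fin n)} {i : Fin n} (hi : i ∈ A₁) :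
    canonicalRay i ∈ simplexCone A₁ A₂ :=
  Submodule.subset_span (Or.inl ⟨i, hi, rfl⟩)

lemma neg_canonicalRay_mem_simplexCone {n : ℕ} {A₁ A₂ : Finset (Fin n)} {i : Fin n}
    (hi : i ∈ A₂) : -canonicalRay i ∈ simplexCone A₁ A₂ :=
  Submodule.subset_span (Or.inr ⟨i, hi, rfl⟩)

/-- The cone spanned by a simplex of the deleted join, described by inequalities. -/
lemma mem_simplexCone_iff {n : ℕ} {A₁ A₂ : Finset (Fin n)} (h : Disjoint A₁ A₂)
    (u : hyperplaneZero n) :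
    u ∈ simplexCone A₁ A₂ ↔ ∃ t : ℝ, ∀ i,
      (i ∉ A₂ → t ≤ (u : EuclideanSpace ℝ (Fin n)) i) ∧
        (i ∉ A₁ → (u : EuclideanSpace ℝ (Fin n)) i ≤ t) := by
  constructor
  · intro hu
    refine Submodule.span_induction (p := fun (u : hyperplaneZero n) _ => ∃ t : ℝ, ∀ i,
      (i ∉ A₂ → t ≤ (u : EuclideanSpace ℝ (Fin n)) i) ∧
        (i ∉ A₁ → (u : EuclideanSpace ℝ (Fin n)) i ≤ t)) ?_ ?_ ?_ ?_ hu
    · rintro _ (⟨i, hi, rfl⟩ | ⟨i, hi, rfl⟩)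
      -- The level is the common value of the coordinates of `δᵢ` other than the `i`-th.
      · refine ⟨-(n : ℝ)⁻¹, fun j => ⟨fun _ => ?_, fun hj => ?_⟩⟩
        · simp only [canonicalRay_apply]
          split_ifs <;> linarith
        · have : j ≠ i := by rintro rfl; exact hj hi
          simp [canonicalRay_apply, this]
      · refine ⟨(n : ℝ)⁻¹, fun j => ⟨fun hj => ?_, fun _ => ?_⟩⟩
        · have : j ≠ i := by rintro rfl; exact hj hi
          simp [canonicalRay_apply, this]
        · simp only [Submodule.coe_neg, PiLp.neg_apply, canonicalRay_apply]
          split_ifs <;> linarith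
    · exact ⟨0, fun i => by simp⟩
    · rintro x y - - ⟨s, hs⟩ ⟨t, ht⟩
      refine ⟨s + t, fun i => ⟨fun hi => ?_, fun hi => ?_⟩⟩
      · exact add_le_add ((hs i).1 hi) ((ht i).1 hi)
      · exact add_le_add ((hs i).2 hi) ((ht i).2 hi)
    · rintro ⟨a, ha⟩ x - ⟨s, hs⟩
      refine ⟨a * s, fun i => ⟨fun hi => ?_, fun hi => ?_⟩⟩
      · exact mul_le_mul_of_nonneg_left ((hs i).1 hi) ha
      · exact mul_le_mul_of_nonneg_left ((hs i).2 hi) ha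
  · rintro ⟨t, ht⟩
    rw [← sum_smul_canonicalRay u t]
    refine Submodule.sum_mem _ fun i _ => ?_
    by_cases h₁ : i ∈ A₁
    · have h₀ := sub_nonneg.2 ((ht i).1 (Finset.disjoint_left.1 h h₁))
      exact Submodule.smul_mem _ (⟨_, h₀⟩ : {c : ℝ // 0 ≤ c})
        (canonicalRay_mem_simplexCone (A₂ := A₂) h₁)
    · have h₀ := sub_nonneg.2 ((ht i).2 h₁)
      by_cases h₂ : i ∈ A₂
      · have := Submodule.smul_mem _ (⟨_, h₀⟩ : {c : ℝ // 0 ≤ c})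
          (neg_canonicalRay_mem_simplexCone (A₁ := A₁) h₂)
        convert this using 1
        change _ = (t - _) • -canonicalRay i
        module
      · rw [le_antisymm ((ht i).2 h₁) ((ht i).1 h₂), sub_self, zero_smul]
        exact Submodule.zero_mem _

/-- If the two parts covered `[n]`, the complement of the second would be the first, a member of
`K`. -/
lemma exists_notMem_of_mem_bierSphere {n : ℕ} {K : Set (Finset (Fin n))}
    {τ : Finset (Fin n) × Finset (Fin n)} (hτ : τ ∈ bierSphere K) : ∃ v, v ∉ τ.1 ∧ v ∉ τ.2 := by
  by_contra! h
  obtain ⟨h₁, h₂, hd⟩ := hτ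
  refine h₂ ?_
  convert h₁
  ext i
  rw [Finset.mem_compl]
  exact ⟨fun hi => by_contra fun hi' => hi (h i hi'), fun hi => Finset.disjoint_left.1 hd hi⟩

/-- Otherwise the level is at most `1/n - 1`, below the value `1/n` of every other coordinate. This
forces `[n] \ {i} ⊆ τ.1 ∈ K`, against `{i} ∈ K°`. -/
lemma mem_snd_of_neg_canonicalRay_mem {n : ℕ} {K : Set (Finset (Fin n))} (hK : IsLowerSet K)
    {τ : Finset (Fin n) × Finset (Fin n)} (hτ : τ ∈ bierSphere K) {i : Fin n}
    (hi : {i} ∈ alexanderDual K) (h : -canonicalRay i ∈ simplexCone τ.1 τ.2) : i ∈ τ.2 := by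
  obtain ⟨t, ht⟩ := (mem_simplexCone_iff hτ.2.2 _).1 h
  simp only [Submodule.coe_neg, PiLp.neg_apply, canonicalRay_apply] at ht
  by_contra h₂
  have hti := (ht i).1 h₂
  simp only [if_true] at hti
  have key : ∀ j, j ≠ i → j ∈ τ.1 := by
    intro j hj
    by_contra h₁
    have := (ht j).2 h₁
    simp only [hj, if_false] at this
    linarith
  refine hi (hK (fun j hj => key j ?_) hτ.1)
  simpa using hj

lemma canonicalRay_notMem_of_mem_snd {n : ℕ} {K : Set (Finset (Fin n))}
    {τ : Finset (Fin n) × Finset (Fin n)} (hτ : τ ∈ bierSphere K) {i : Fin n} (hi : i ∈ τ.2) :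
    canonicalRay i ∉ simplexCone τ.1 τ.2 := by
  intro h
  obtain ⟨t, ht⟩ := (mem_simplexCone_iff hτ.2.2 _).1 h
  obtain ⟨v, hv₁, hv₂⟩ := exists_notMem_of_mem_bierSphere hτ
  have hvi : v ≠ i := by rintro rfl; exact hv₂ hi
  have h₁ := (ht i).2 (Finset.disjoint_right.1 hτ.2.2 hi)
  have h₂ := (ht v).1 hv₂
  simp only [canonicalRay_apply, hvi, if_true, if_false] at h₁ h₂
  linarith

/-! ### Normal fans -/

section NormalFan

variable {V : Type*} [NormedAddCommGroup V] [InnerProductSpace ℝ V]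

lemma IsConvexPolytope.isCompact {Q : Set V} (hQ : IsConvexPolytope Q) : IsCompact Q := by
  obtain ⟨s, hs, -, rfl⟩ := hQ
  exact hs.isCompact_convexHull ℝ

lemma IsConvexPolytope.nonempty {Q : Set V} (hQ : IsConvexPolytope Q) : Q.Nonempty := by
  obtain ⟨s, -, hs, rfl⟩ := hQ
  exact hs.convexHull

lemma IsConvexPolytope.exists_forall_inner_le {Q : Set V} (hQ : IsConvexPolytope Q) (u : V) :
    ∃ x ∈ Q, ∀ y ∈ Q, inner ℝ u y ≤ inner ℝ u x :=
  hQ.isCompact.exists_isMaxOn hQ.nonempty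
    (by fun_prop : Continuous fun y => inner ℝ u y).continuousOn

/-- The face of `Q` on which `⟨u, ·⟩` is maximal. -/
def supportFace (Q : Set V) (u : V) : Set V :=
  {x ∈ Q | ∀ y ∈ Q, inner ℝ u y ≤ inner ℝ u x}

lemma isExposed_supportFace (Q : Set V) (u : V) : IsExposed ℝ Q (supportFace Q u) :=
  fun _ => ⟨innerSL ℝ u, by simp [supportFace]⟩

lemma normalCone_supportFace_mem_normalFan {Q : Set V} {u : V} (h : (supportFace Q u).Nonempty) :
    normalCone Q (supportFace Q u) ∈ normalFan Q :=
  ⟨_, isExposed_supportFace Q u, h, rfl⟩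

end NormalFan

/-! ### From polytopal fans to threshold complexes -/

theorem isThresholdComplex_of_isPolytopalFan {n : ℕ} {K : Set (Finset (Fin n))}
    (hK : IsSimplicialComplex K) (huniv : Finset.univ ∉ K)
    (h : IsPolytopalFan (canonicalFan K)) :
    IsThresholdComplex K := by
  classical
  obtain ⟨Q, hQ, hfan⟩ := h
  choose m hmQ hm using hQ.exists_forall_inner_le
  set p : hyperplaneZero n → ℝ := fun u => inner ℝ u (m u) with hp
  have hsupp : ∀ u, m u ∈ supportFace Q u := fun u => ⟨hmQ u, hm u⟩
  have hface : ∀ u, ∃ τ ∈ bierSphere K, normalCone Q (supportFace Q u) = simplexCone τ.1 τ.2 := by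
    intro u
    have := normalCone_supportFace_mem_normalFan ⟨_, hsupp u⟩
    rwa [← hfan] at this
  -- The support function is linear on the cones of the fan.
  have hlin : ∀ τ ∈ bierSphere K, ∃ x ∈ Q, ∀ u ∈ simplexCone τ.1 τ.2, p u = inner ℝ u x := by
    intro τ hτ
    obtain ⟨F, hF, ⟨x, hx⟩, hC⟩ : simplexCone τ.1 τ.2 ∈ normalFan Q := hfan ▸ ⟨τ, hτ, rfl⟩
    refine ⟨x, hF.subset hx, fun u hu => ?_⟩
    rw [hC] at hu
    exact le_antisymm (hu x hx _ (hmQ u)) (hm u x (hF.subset hx))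
  have hdual : ∀ A, A ∉ K → Aᶜ ∈ alexanderDual K := fun A hA => by simpa [alexanderDual] using hA
  have hdual_mono : ∀ A, A ∉ K → ∀ i ∉ A, {i} ∈ alexanderDual K := by
    intro A hA i hi hmem
    refine hA (hK.isLowerSet (fun j hj => ?_) hmem)
    rw [Finset.mem_compl, Finset.mem_singleton]
    rintro rfl
    exact hi hj
  -- If `{i} ∉ K°`, then `-δᵢ` need not span a cone of the fan and strictness may fail, so 1 is
  -- added. Such an `i` lies in every `A ∉ K` (`hdual_mono`), hence the reverse inequality is
  -- unaffected.
  set ε : Fin n → ℝ := fun i => if {i} ∈ alexanderDual K then 0 else 1 with hε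
  have hε0 : ∀ i, 0 ≤ ε i := fun i => by simp only [hε]; split_ifs <;> norm_num
  have hsplit : ∀ (A : Finset (Fin n)) (a b : Fin n → ℝ),
      ∑ i ∈ A, (a i + b i) = ∑ i, b i + (∑ i ∈ A, a i - ∑ i ∈ Aᶜ, b i) := by
    intro A a b
    rw [Finset.sum_add_distrib, ← Finset.sum_add_sum_compl A b]
    ring
  have hmemK : ∀ A ∈ K, ∑ i ∈ A, p (canonicalRay i) < ∑ i ∈ Aᶜ, (p (-canonicalRay i) + ε i) := by
    intro A hA
    have hτ : (A, (∅ : Finset (Fin n))) ∈ bierSphere K := by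
      refine ⟨hA, ?_, Finset.disjoint_empty_right _⟩
      simpa [alexanderDual] using huniv
    obtain ⟨x, hx, hxp⟩ := hlin _ hτ
    set u := ∑ i ∈ A, canonicalRay i with hu
    have hux : ∑ i ∈ A, p (canonicalRay i) = inner ℝ u x := by
      rw [hu, sum_inner]
      exact Finset.sum_congr rfl fun i hi => hxp _ (canonicalRay_mem_simplexCone hi)
    have hux' : inner ℝ u x = ∑ i ∈ Aᶜ, inner ℝ (-canonicalRay i) x := by
      rw [hu, sum_canonicalRay_eq_sum_compl, sum_inner]
    have hle : ∀ i, inner ℝ (-canonicalRay i) x ≤ p (-canonicalRay i) + ε i := fun i =>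
      (hm _ x hx).trans (le_add_of_nonneg_right (hε0 i))
    rw [hux, hux']
    refine (Finset.sum_le_sum fun i _ => hle i).lt_of_ne fun heq => ?_
    -- Equality holds termwise: every `i ∉ A` has `ε i = 0`, and `x` maximises each such `-δᵢ`.
    rw [Finset.sum_eq_sum_iff_of_le fun i _ => hle i] at heq
    have hvertex : ∀ i ∈ Aᶜ, {i} ∈ alexanderDual K := by
      intro i hi
      by_contra hni
      have h₁ := heq i hi
      have h₂ := hm (-canonicalRay i) x hx
      simp only [hε, hni, if_false, hp] at h₁
      linarith
    have heq' : ∀ i ∈ Aᶜ, p (-canonicalRay i) = inner ℝ (-canonicalRay i) x := by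
      intro i hi
      have h₁ := heq i hi
      simp only [hε, hvertex i hi, if_true] at h₁
      linarith
    -- Every maximiser of `u` now maximises each `-δᵢ` with `i ∉ A`, so these rays lie in the normal
    -- cone of that face. Then `τ.2ᶜ ⊆ A` is in `K`, against `τ.2 ∈ K°`.
    obtain ⟨τ, hτ, hC⟩ := hface u
    have hsub : Aᶜ ⊆ τ.2 := by
      intro i hi
      refine mem_snd_of_neg_canonicalRay_mem hK.isLowerSet hτ (hvertex i hi) ?_
      rw [← hC]
      intro z hz y hy
      have hzx := hz.2 x hx
      rw [hux', hu, sum_canonicalRay_eq_sum_compl, sum_inner] at hzx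
      have hzle : ∀ j ∈ Aᶜ, inner ℝ (-canonicalRay j) z ≤ inner ℝ (-canonicalRay j) x := by
        intro j hj
        rw [← heq' j hj]
        exact hm _ z hz.1
      have := (Finset.sum_eq_sum_iff_of_le hzle).1 (le_antisymm (Finset.sum_le_sum hzle) hzx) i hi
      rw [this, ← heq' i hi]
      exact hm _ y hy
    refine hτ.2.1 (hK.isLowerSet ?_ hA)
    intro i hi
    by_contra hiA
    exact Finset.mem_compl.1 hi (hsub (Finset.mem_compl.2 hiA))
  have hnotMemK : ∀ A, A ∉ K →
      ∑ i ∈ Aᶜ, (p (-canonicalRay i) + ε i) ≤ ∑ i ∈ A, p (canonicalRay i) := by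
    intro A hA
    have hτ : ((∅ : Finset (Fin n)), Aᶜ) ∈ bierSphere K :=
      ⟨hK.empty_mem, hdual A hA, Finset.disjoint_empty_left _⟩
    obtain ⟨x, hx, hxp⟩ := hlin _ hτ
    calc ∑ i ∈ Aᶜ, (p (-canonicalRay i) + ε i) = ∑ i ∈ Aᶜ, inner ℝ (-canonicalRay i) x := by
          refine Finset.sum_congr rfl fun i hi => ?_
          rw [← hxp _ (neg_canonicalRay_mem_simplexCone hi)]
          simp [hε, hdual_mono A hA i (Finset.mem_compl.1 hi)]
      _ = ∑ i ∈ A, inner ℝ (canonicalRay i) x := by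
          rw [← sum_inner, ← sum_inner, sum_canonicalRay_eq_sum_compl]
      _ ≤ ∑ i ∈ A, p (canonicalRay i) := Finset.sum_le_sum fun i _ => hm _ x hx
  refine ⟨fun i => p (canonicalRay i) + (p (-canonicalRay i) + ε i),
    ∑ i, (p (-canonicalRay i) + ε i), fun i => ?_, ?_, ?_⟩
  · have hwidth : ∀ x ∈ Q, ∀ y ∈ Q,
        inner ℝ (canonicalRay i) y - inner ℝ (canonicalRay i) x
          ≤ p (canonicalRay i) + p (-canonicalRay i) := by
      intro x hx y hy
      have h₁ := hm (canonicalRay i) y hy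
      have h₂ := hm (-canonicalRay i) x hx
      rw [inner_neg_left (canonicalRay i) x] at h₂
      simp only [hp]
      linarith
    have hnonneg : 0 ≤ p (canonicalRay i) + p (-canonicalRay i) := by
      simpa using hwidth (m 0) (hmQ 0) (m 0) (hmQ 0)
    by_cases hi : {i} ∈ alexanderDual K
    · simp only [hε, hi, if_true, add_zero]
      refine hnonneg.lt_of_ne fun heq => ?_
      rw [← heq] at hwidth
      -- The support face of `0` is `Q` itself; zero width would put both `δᵢ` and `-δᵢ` in its
      -- normal cone.
      obtain ⟨τ, hτ, hC⟩ := hface 0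
      have hpos : canonicalRay i ∈ simplexCone τ.1 τ.2 := by
        rw [← hC]
        intro x hx y hy
        linarith [hwidth x hx.1 y hy]
      have hneg : -canonicalRay i ∈ simplexCone τ.1 τ.2 := by
        rw [← hC]
        intro x hx y hy
        rw [inner_neg_left, inner_neg_left]
        linarith [hwidth y hy x hx.1]
      exact canonicalRay_notMem_of_mem_snd hτ
        (mem_snd_of_neg_canonicalRay_mem hK.isLowerSet hτ hi hneg) hpos
    · simp only [hε, hi, if_false]
      linarith
  · simpa using hmemK ∅ hK.empty_mem
  · ext A
    rw [Set.mem_ofPred_eq, hsplit A (fun i => p (canonicalRay i))]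
    constructor
    · intro hA
      linarith [hmemK A hA]
    · intro hA
      by_contra hA'
      linarith [hnotMemK A hA']

/-! ### Sections of boxes by `H₀` -/

/-- The part of `H₀` in the box `∏ᵢ [loᵢ, hiᵢ]`. -/
def boxSection {n : ℕ} (lo hi : Fin n → ℝ) : Set (hyperplaneZero n) :=
  {x | ∀ i, lo i ≤ (x : EuclideanSpace ℝ (Fin n)) i ∧ (x : EuclideanSpace ℝ (Fin n)) i ≤ hi i}

/-- The coordinates in which `x` attains the given bounds. -/
noncomputable def contactSet {n : ℕ} (b : Fin n → ℝ) (x : hyperplaneZero n) : Finset (Fin n) :=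
  Finset.univ.filter fun i => (x : EuclideanSpace ℝ (Fin n)) i = b i

lemma mem_contactSet {n : ℕ} {b : Fin n → ℝ} {x : hyperplaneZero n} {i : Fin n} :
    i ∈ contactSet b x ↔ (x : EuclideanSpace ℝ (Fin n)) i = b i := by
  simp [contactSet]

section BoxSection

variable {n : ℕ} {lo hi : Fin n → ℝ}

lemma convex_boxSection (lo hi : Fin n → ℝ) : Convex ℝ (boxSection lo hi) := by
  intro x hx y hy a b ha hb hab i
  exact (convex_Icc (lo i) (hi i)) (hx i) (hy i) ha hb hab

lemma isCompact_boxSection (lo hi : Fin n → ℝ) : IsCompact (boxSection lo hi) := by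
  refine Metric.isCompact_of_isClosed_isBounded ?_ ?_
  · simp only [boxSection, Set.ofPred_forall, Set.ofPred_and]
    refine isClosed_iInter fun i => IsClosed.inter ?_ ?_
    · exact isClosed_le (by fun_prop) (by fun_prop)
    · exact isClosed_le (by fun_prop) (by fun_prop)
  · refine isBounded_iff_forall_norm_le.2 ⟨∑ i, (|lo i| + |hi i|) * ‖canonicalRay i‖,
      fun x hx => ?_⟩
    rw [← sum_smul_canonicalRay x 0]
    refine norm_sum_le_of_le _ fun i _ => (norm_smul_le _ _).trans ?_
    refine mul_le_mul_of_nonneg_right ?_ (norm_nonneg _)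
    rw [sub_zero, Real.norm_eq_abs, abs_le]
    obtain ⟨h₁, h₂⟩ := hx i
    constructor
    · linarith [neg_abs_le (lo i), abs_nonneg (hi i)]
    · linarith [le_abs_self (hi i), abs_nonneg (lo i)]

/-- Near a point, the box section contains every direction that keeps the attained bounds. -/
lemma exists_add_smul_mem_boxSection {y d : hyperplaneZero n} (hy : y ∈ boxSection lo hi)
    (hhi : ∀ i ∈ contactSet hi y, (d : EuclideanSpace ℝ (Fin n)) i ≤ 0)
    (hlo : ∀ i ∈ contactSet lo y, 0 ≤ (d : EuclideanSpace ℝ (Fin n)) i) :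
    ∃ ε : ℝ, 0 < ε ∧ y + ε • d ∈ boxSection lo hi := by
  have key : ∀ᶠ ε : ℝ in nhdsWithin 0 (Set.Ioi 0), y + ε • d ∈ boxSection lo hi := by
    refine Filter.eventually_all.2 fun i => ?_
    have hcont : Filter.Tendsto (fun ε : ℝ => (y : EuclideanSpace ℝ (Fin n)) i
        + ε * (d : EuclideanSpace ℝ (Fin n)) i) (nhdsWithin 0 (Set.Ioi 0))
        (nhds ((y : EuclideanSpace ℝ (Fin n)) i)) := by
      refine Filter.Tendsto.mono_left ?_ nhdsWithin_le_nhds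
      refine Continuous.tendsto' (by fun_prop) _ _ (by simp)
    refine Filter.Eventually.and ?_ ?_
    · by_cases h : i ∈ contactSet lo y
      · filter_upwards [self_mem_nhdsWithin] with ε hε
        exact (hy i).1.trans (le_add_of_nonneg_right (mul_nonneg (le_of_lt hε) (hlo i h)))
      · have := lt_of_le_of_ne (hy i).1 fun h' => h (mem_contactSet.2 h'.symm)
        exact (hcont.eventually (lt_mem_nhds this)).mono fun ε hε => hε.le
    · by_cases h : i ∈ contactSet hi y
      · filter_upwards [self_mem_nhdsWithin] with ε hε
        exact (add_le_of_nonpos_right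
          (mul_nonpos_of_nonneg_of_nonpos (le_of_lt hε) (hhi i h))).trans (hy i).2
      · have := lt_of_le_of_ne (hy i).2 fun h' => h (mem_contactSet.2 h')
        exact (hcont.eventually (gt_mem_nhds this)).mono fun ε hε => hε.le
  obtain ⟨ε, h₁, h₂⟩ := (key.and self_mem_nhdsWithin).exists
  exact ⟨ε, h₂, h₁⟩

/-- The direction `z - y` vanishes at all bounds attained by `y`, so `y` can move both ways along
it; extremality forces `z = y`. -/
lemma eq_of_contactSet_eq {y z : hyperplaneZero n} (hy : y ∈ (boxSection lo hi).extremePoints ℝ)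
    (hhi : contactSet hi y = contactSet hi z) (hlo : contactSet lo y = contactSet lo z) :
    y = z := by
  have hd : ∀ b : Fin n → ℝ, contactSet b y = contactSet b z → ∀ i ∈ contactSet b y,
      ((z - y : hyperplaneZero n) : EuclideanSpace ℝ (Fin n)) i = 0 := by
    intro b hb i hi
    have h₁ := mem_contactSet.1 hi
    have h₂ := mem_contactSet.1 (hb ▸ hi)
    simp [h₁, h₂]
  obtain ⟨ε, hε, hmem⟩ := exists_add_smul_mem_boxSection (d := z - y) hy.1
    (fun i h => (hd hi hhi i h).le) (fun i h => (hd lo hlo i h).ge)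
  obtain ⟨η, hη, hmem'⟩ := exists_add_smul_mem_boxSection (d := -(z - y)) hy.1
    (fun i h => by simpa using (hd hi hhi i h).ge) (fun i h => by simpa using (hd lo hlo i h).le)
  have hseg : y ∈ openSegment ℝ (y + ε • (z - y)) (y + η • -(z - y)) := by
    refine ⟨η / (ε + η), ε / (ε + η), by positivity, by positivity, by field_simp; ring, ?_⟩
    have : ε + η ≠ 0 := by positivity
    match_scalars <;> field_simp <;> ring
  have := hy.2 hmem hmem' hseg
  rw [add_eq_left, smul_eq_zero, sub_eq_zero] at this
  exact (this.resolve_left hε.ne').symm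

/-- Extreme points are determined by their contact sets, so they are finite in number, and
Krein–Milman applies. -/
lemma isConvexPolytope_boxSection (h : (boxSection lo hi).Nonempty) :
    IsConvexPolytope (boxSection lo hi) := by
  have hcompact := isCompact_boxSection lo hi
  have hfin : ((boxSection lo hi).extremePoints ℝ).Finite := by
    refine Set.Finite.of_injOn (f := fun y => (contactSet hi y, contactSet lo y))
      (t := Set.univ) (fun _ _ => Set.mem_univ _) (fun y hy z _ hyz => ?_) Set.finite_univ
    exact eq_of_contactSet_eq hy (congrArg Prod.fst hyz) (congrArg Prod.snd hyz)
  refine ⟨_, hfin, hcompact.extremePoints_nonempty h, ?_⟩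
  rw [← (hfin.isCompact_convexHull ℝ).isClosed.closure_eq,
    closure_convexHull_extremePoints hcompact (convex_boxSection lo hi)]

lemma disjoint_contactSet (hlt : ∀ i, lo i < hi i) (y : hyperplaneZero n) :
    Disjoint (contactSet hi y) (contactSet lo y) :=
  Finset.disjoint_left.2 fun i h₁ h₂ =>
    (hlt i).ne ((mem_contactSet.1 h₂).symm.trans (mem_contactSet.1 h₁))

lemma inner_le_of_mem_simplexCone {A₁ A₂ : Finset (Fin n)} {u y z : hyperplaneZero n}
    (hu : u ∈ simplexCone A₁ A₂)
    (h₁ : ∀ i ∈ A₁, (z : EuclideanSpace ℝ (Fin n)) i ≤ (y : EuclideanSpace ℝ (Fin n)) i)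
    (h₂ : ∀ i ∈ A₂, (y : EuclideanSpace ℝ (Fin n)) i ≤ (z : EuclideanSpace ℝ (Fin n)) i) :
    inner ℝ u z ≤ inner ℝ u y := by
  refine Submodule.span_induction (p := fun u _ => inner ℝ u z ≤ inner ℝ u y) ?_ ?_ ?_ ?_ hu
  · rintro _ (⟨i, hi, rfl⟩ | ⟨i, hi, rfl⟩)
    · simpa only [inner_canonicalRay] using h₁ i hi
    · simpa only [inner_neg_left, inner_canonicalRay, neg_le_neg_iff] using h₂ i hi
  · simp
  · intro u v _ _ hu hv
    simpa only [inner_add_left] using add_le_add hu hv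
  · rintro ⟨a, ha⟩ u - hu
    change inner ℝ (a • u) z ≤ inner ℝ (a • u) y
    simpa only [inner_smul_left_hyperplaneZero] using mul_le_mul_of_nonneg_left hu ha

/-- If `H₀` contains no vertex of the box, every point of `H₀` has a coordinate attaining neither
of its bounds. -/
lemma exists_notMem_contactSet (hne : ∀ A : Finset (Fin n), ∑ i ∈ A, hi i + ∑ i ∈ Aᶜ, lo i ≠ 0)
    (y : hyperplaneZero n) : ∃ k, k ∉ contactSet hi y ∧ k ∉ contactSet lo y := by
  by_contra! h
  refine hne (contactSet hi y) ?_
  rw [← sum_coe_eq_zero y, ← Finset.sum_add_sum_compl (contactSet hi y)]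
  congr 1
  · exact Finset.sum_congr rfl fun i hi => (mem_contactSet.1 hi).symm
  · exact Finset.sum_congr rfl fun i hi => (mem_contactSet.1 (h i (Finset.mem_compl.1 hi))).symm

lemma normalCone_singleton_boxSection (hlt : ∀ i, lo i < hi i)
    (hne : ∀ A : Finset (Fin n), ∑ i ∈ A, hi i + ∑ i ∈ Aᶜ, lo i ≠ 0)
    {y : hyperplaneZero n} (hy : y ∈ boxSection lo hi) :
    normalCone (boxSection lo hi) {y} = simplexCone (contactSet hi y) (contactSet lo y) := by
  ext u
  constructor
  · intro hu
    obtain ⟨k, hk₁, hk₂⟩ := exists_notMem_contactSet hne y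
    rw [mem_simplexCone_iff (disjoint_contactSet hlt y)]
    have hmove : ∀ d : hyperplaneZero n,
        (∀ i ∈ contactSet hi y, (d : EuclideanSpace ℝ (Fin n)) i ≤ 0) →
        (∀ i ∈ contactSet lo y, 0 ≤ (d : EuclideanSpace ℝ (Fin n)) i) → inner ℝ u d ≤ 0 := by
      intro d h₁ h₂
      obtain ⟨ε, hε, hmem⟩ := exists_add_smul_mem_boxSection hy h₁ h₂
      have := hu y rfl _ hmem
      rw [inner_add_right, inner_smul_right_hyperplaneZero, add_le_iff_nonpos_right] at this
      exact nonpos_of_mul_nonpos_right this hε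
    -- The coordinate `k` is free to move both ways, so the exchanges `±(e_k - eᵢ)`, which stay in
    -- `H₀`, compare `uᵢ` with the level `u_k`.
    refine ⟨(u : EuclideanSpace ℝ (Fin n)) k, fun i => ⟨fun hi₂ => ?_, fun hi₁ => ?_⟩⟩
    · have := hmove (canonicalRay k - canonicalRay i) (fun j hj => ?_) (fun j hj => ?_)
      · rw [inner_sub_right, real_inner_comm, inner_canonicalRay, real_inner_comm,
          inner_canonicalRay] at this
        linarith
      · have : j ≠ k := by rintro rfl; exact hk₁ hj
        simp only [Submodule.coe_sub, PiLp.sub_apply, canonicalRay_apply, this, if_false]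
        split_ifs <;> linarith
      · have : j ≠ i := by rintro rfl; exact hi₂ hj
        simp only [Submodule.coe_sub, PiLp.sub_apply, canonicalRay_apply, this, if_false]
        split_ifs <;> linarith
    · have := hmove (canonicalRay i - canonicalRay k) (fun j hj => ?_) (fun j hj => ?_)
      · rw [inner_sub_right, real_inner_comm, inner_canonicalRay, real_inner_comm,
          inner_canonicalRay] at this
        linarith
      · have : j ≠ i := by rintro rfl; exact hi₁ hj
        simp only [Submodule.coe_sub, PiLp.sub_apply, canonicalRay_apply, this, if_false]
        split_ifs <;> linarith
      · have : j ≠ k := by rintro rfl; exact hk₂ hj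
        simp only [Submodule.coe_sub, PiLp.sub_apply, canonicalRay_apply, this, if_false]
        split_ifs <;> linarith
  · rintro hu _ rfl z hz
    refine inner_le_of_mem_simplexCone hu (fun i hi => ?_) (fun i hi => ?_)
    · exact mem_contactSet.1 hi ▸ (hz i).2
    · exact mem_contactSet.1 hi ▸ (hz i).1

/-- A convex subset of the box section has a point attaining only those bounds that are attained
on the whole subset. -/
lemma exists_contactSet_subset {F : Set (hyperplaneZero n)} (hF : F ⊆ boxSection lo hi)
    (hconv : Convex ℝ F) (hne : F.Nonempty) :
    ∃ y ∈ F, ∀ z ∈ F, contactSet hi y ⊆ contactSet hi z ∧ contactSet lo y ⊆ contactSet lo z := by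
  obtain ⟨y, hy, hmin⟩ := exists_minimalFor_of_wellFoundedLT (· ∈ F)
    (fun y => (contactSet hi y, contactSet lo y)) hne
  refine ⟨y, hy, fun z hz => ?_⟩
  -- The midpoint attains a bound only where both `y` and `z` do.
  set x := (1 / 2 : ℝ) • y + (1 / 2 : ℝ) • z with hx
  have hxF : x ∈ F := hconv hy hz (by norm_num) (by norm_num) (by norm_num)
  have hxi : ∀ i, (x : EuclideanSpace ℝ (Fin n)) i = 1 / 2 * (y : EuclideanSpace ℝ (Fin n)) i
      + 1 / 2 * (z : EuclideanSpace ℝ (Fin n)) i := fun i => rfl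
  have h₁ : ∀ i ∈ contactSet hi x, i ∈ contactSet hi y ∧ i ∈ contactSet hi z := by
    intro i h
    simp only [mem_contactSet, hxi] at h ⊢
    constructor <;> linarith [(hF hy i).2, (hF hz i).2]
  have h₂ : ∀ i ∈ contactSet lo x, i ∈ contactSet lo y ∧ i ∈ contactSet lo z := by
    intro i h
    simp only [mem_contactSet, hxi] at h ⊢
    constructor <;> linarith [(hF hy i).1, (hF hz i).1]
  obtain ⟨h₃, h₄⟩ := hmin hxF ⟨fun i h => (h₁ i h).1, fun i h => (h₂ i h).1⟩
  exact ⟨fun i h => (h₁ i (h₃ h)).2, fun i h => (h₂ i (h₄ h)).2⟩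

lemma normalCone_boxSection_of_isExposed (hlt : ∀ i, lo i < hi i)
    (hne : ∀ A : Finset (Fin n), ∑ i ∈ A, hi i + ∑ i ∈ Aᶜ, lo i ≠ 0)
    {F : Set (hyperplaneZero n)} (hF : IsExposed ℝ (boxSection lo hi) F) (hFne : F.Nonempty) :
    ∃ y ∈ boxSection lo hi,
      normalCone (boxSection lo hi) F = simplexCone (contactSet hi y) (contactSet lo y) := by
  obtain ⟨y, hy, hmin⟩ :=
    exists_contactSet_subset hF.subset (hF.convex (convex_boxSection lo hi)) hFne
  refine ⟨y, hF.subset hy, ?_⟩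
  refine Set.Subset.antisymm ?_ ?_
  · rw [← normalCone_singleton_boxSection hlt hne (hF.subset hy)]
    rintro u hu _ rfl
    exact hu _ hy
  · intro u hu z hz x hx
    refine inner_le_of_mem_simplexCone hu (fun i hi => ?_) (fun i hi => ?_)
    · exact mem_contactSet.1 ((hmin z hz).1 hi) ▸ (hx i).2
    · exact mem_contactSet.1 ((hmin z hz).2 hi) ▸ (hx i).1

lemma sum_contactSet_nonpos {y : hyperplaneZero n} (hy : y ∈ boxSection lo hi) :
    ∑ i ∈ contactSet hi y, hi i + ∑ i ∈ (contactSet hi y)ᶜ, lo i ≤ 0 := by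
  rw [← sum_coe_eq_zero y, ← Finset.sum_add_sum_compl (contactSet hi y)]
  refine add_le_add (Finset.sum_le_sum fun i hi => ?_) (Finset.sum_le_sum fun i _ => (hy i).1)
  exact (mem_contactSet.1 hi).ge

lemma sum_compl_contactSet_nonneg {y : hyperplaneZero n} (hy : y ∈ boxSection lo hi) :
    0 ≤ ∑ i ∈ (contactSet lo y)ᶜ, hi i + ∑ i ∈ contactSet lo y, lo i := by
  rw [← sum_coe_eq_zero y, add_comm, ← Finset.sum_add_sum_compl (contactSet lo y)]
  refine add_le_add (Finset.sum_le_sum fun i hi => ?_) (Finset.sum_le_sum fun i _ => (hy i).2)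
  exact (mem_contactSet.1 hi).le

/-- Every admissible pair of contact sets is attained. -/
lemma exists_contactSet_eq (hlt : ∀ i, lo i < hi i) {A₁ A₂ : Finset (Fin n)}
    (hd : Disjoint A₁ A₂) (h₁ : ∑ i ∈ A₁, hi i + ∑ i ∈ A₁ᶜ, lo i < 0)
    (h₂ : 0 < ∑ i ∈ A₂ᶜ, hi i + ∑ i ∈ A₂, lo i) :
    ∃ y ∈ boxSection lo hi, contactSet hi y = A₁ ∧ contactSet lo y = A₂ := by
  -- `f` and `g` are the lowest and highest box points with the prescribed contacts. Their sums have
  -- opposite signs, so a proper convex combination lies in `H₀`; outside `A₁ ∪ A₂` it is strictly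
  -- between the bounds.
  set f : Fin n → ℝ := fun i => if i ∈ A₁ then hi i else lo i with hf
  set g : Fin n → ℝ := fun i => if i ∈ A₂ then lo i else hi i with hg
  have hfsum : ∑ i, f i < 0 := by
    rw [← Finset.sum_add_sum_compl A₁]
    refine lt_of_eq_of_lt ?_ h₁
    congr 1
    · exact Finset.sum_congr rfl fun i hi => by simp [hf, hi]
    · exact Finset.sum_congr rfl fun i hi => by simp [hf, Finset.mem_compl.1 hi]
  have hgsum : 0 < ∑ i, g i := by
    rw [← Finset.sum_add_sum_compl A₂, add_comm]
    refine lt_of_lt_of_eq h₂ ?_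
    congr 1
    · exact Finset.sum_congr rfl fun i hi => by simp [hg, Finset.mem_compl.1 hi]
    · exact Finset.sum_congr rfl fun i hi => by simp [hg, hi]
  set S := ∑ i, g i - ∑ i, f i with hS
  have hSpos : 0 < S := by linarith
  set a := (∑ i, g i) / S with ha
  set b := -(∑ i, f i) / S with hb
  have hapos : 0 < a := div_pos hgsum hSpos
  have hbpos : 0 < b := div_pos (by linarith) hSpos
  have hab : a + b = 1 := by
    rw [ha, hb, ← add_div, hS, ← sub_eq_add_neg, div_self hSpos.ne']
  have hsum : ∑ i, (a * f i + b * g i) = 0 := by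
    rw [Finset.sum_add_distrib, ← Finset.mul_sum, ← Finset.mul_sum, ha, hb]
    ring
  let y : hyperplaneZero n := ⟨WithLp.toLp 2 fun i => a * f i + b * g i, hsum⟩
  have hyi : ∀ i, (y : EuclideanSpace ℝ (Fin n)) i = a * f i + b * g i := fun i => rfl
  have hb' : b = 1 - a := by linarith
  have hy₁ : ∀ i ∈ A₁, (y : EuclideanSpace ℝ (Fin n)) i = hi i := by
    intro i hi
    simp only [hyi, hf, hg, hi, Finset.disjoint_left.1 hd hi, if_true, if_false, hb']
    ring
  have hy₂ : ∀ i ∈ A₂, (y : EuclideanSpace ℝ (Fin n)) i = lo i := by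
    intro i hi
    simp only [hyi, hf, hg, hi, Finset.disjoint_right.1 hd hi, if_true, if_false, hb']
    ring
  have hy₃ : ∀ i, i ∉ A₁ → i ∉ A₂ → lo i < (y : EuclideanSpace ℝ (Fin n)) i ∧
      (y : EuclideanSpace ℝ (Fin n)) i < hi i := by
    intro i hi₁ hi₂
    have ha' : a = 1 - b := by linarith
    simp only [hyi, hf, hg, hi₁, hi₂, if_false]
    have h₃ := mul_pos hapos (sub_pos.2 (hlt i))
    have h₄ := mul_pos hbpos (sub_pos.2 (hlt i))
    constructor
    · rw [ha']
      linarith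
    · rw [hb']
      linarith
  refine ⟨y, fun i => ?_, ?_, ?_⟩
  · by_cases hi₁ : i ∈ A₁
    · rw [hy₁ i hi₁]
      exact ⟨(hlt i).le, le_rfl⟩
    · by_cases hi₂ : i ∈ A₂
      · rw [hy₂ i hi₂]
        exact ⟨le_rfl, (hlt i).le⟩
      · exact ⟨(hy₃ i hi₁ hi₂).1.le, (hy₃ i hi₁ hi₂).2.le⟩
  · ext i
    rw [mem_contactSet]
    refine ⟨fun h => ?_, hy₁ i⟩
    by_contra hi₁
    by_cases hi₂ : i ∈ A₂
    · exact (hlt i).ne ((hy₂ i hi₂).symm.trans h)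
    · exact (hy₃ i hi₁ hi₂).2.ne h
  · ext i
    rw [mem_contactSet]
    refine ⟨fun h => ?_, hy₂ i⟩
    by_contra hi₂
    by_cases hi₁ : i ∈ A₁
    · exact (hlt i).ne (h.symm.trans (hy₁ i hi₁))
    · exact (hy₃ i hi₁ hi₂).1.ne' h

/-- The sum of the generators is maximised exactly at the points sharing all contacts of `y`, which
exposes the required face. -/
lemma simplexCone_contactSet_mem_normalFan (hlt : ∀ i, lo i < hi i)
    (hne : ∀ A : Finset (Fin n), ∑ i ∈ A, hi i + ∑ i ∈ Aᶜ, lo i ≠ 0)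
    {y : hyperplaneZero n} (hy : y ∈ boxSection lo hi) :
    simplexCone (contactSet hi y) (contactSet lo y) ∈ normalFan (boxSection lo hi) := by
  set u : hyperplaneZero n :=
    ∑ i ∈ contactSet hi y, canonicalRay i + ∑ i ∈ contactSet lo y, -canonicalRay i with hu
  have hucone : u ∈ simplexCone (contactSet hi y) (contactSet lo y) :=
    Submodule.add_mem _ (Submodule.sum_mem _ fun i hi => canonicalRay_mem_simplexCone hi)
      (Submodule.sum_mem _ fun i hi => neg_canonicalRay_mem_simplexCone hi)
  have hcone := normalCone_singleton_boxSection hlt hne hy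
  have hyface : y ∈ supportFace (boxSection lo hi) u := by
    rw [← hcone] at hucone
    exact ⟨hy, hucone y rfl⟩
  have hui : ∀ z, inner ℝ u z = ∑ i ∈ contactSet hi y, (z : EuclideanSpace ℝ (Fin n)) i
      + ∑ i ∈ contactSet lo y, -(z : EuclideanSpace ℝ (Fin n)) i := by
    intro z
    simp only [hu, inner_add_left, sum_inner, inner_neg_left, inner_canonicalRay]
  convert normalCone_supportFace_mem_normalFan ⟨y, hyface⟩ using 1
  refine Set.Subset.antisymm ?_ ?_
  · intro v hv z hz x hx
    have hle := hz.2 y hy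
    have h₁ : ∀ i ∈ contactSet hi y,
        (z : EuclideanSpace ℝ (Fin n)) i ≤ (y : EuclideanSpace ℝ (Fin n)) i :=
      fun i hi => (mem_contactSet.1 hi).symm ▸ (hz.1 i).2
    have h₂ : ∀ i ∈ contactSet lo y,
        -(z : EuclideanSpace ℝ (Fin n)) i ≤ -(y : EuclideanSpace ℝ (Fin n)) i :=
      fun i hi => neg_le_neg ((mem_contactSet.1 hi).symm ▸ (hz.1 i).1)
    have hs₁ := Finset.sum_le_sum h₁
    have hs₂ := Finset.sum_le_sum h₂
    rw [hui, hui] at hle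
    have he₁ := (Finset.sum_eq_sum_iff_of_le h₁).1 (by linarith)
    have he₂ := (Finset.sum_eq_sum_iff_of_le h₂).1 (by linarith)
    refine inner_le_of_mem_simplexCone hv (fun i hi => ?_) (fun i hi => ?_)
    · rw [he₁ i hi, mem_contactSet.1 hi]
      exact (hx i).2
    · rw [neg_inj.1 (he₂ i hi), mem_contactSet.1 hi]
      exact (hx i).1
  · rw [← hcone]
    rintro v hv _ rfl
    exact hv _ hyface

end BoxSection

/-! ### From threshold complexes to polytopal fans -/

/-- The canonical fan of a complex cut out by a generic box is the normal fan of the box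
section. -/
theorem canonicalFan_eq_normalFan_boxSection {n : ℕ} {K : Set (Finset (Fin n))} {lo hi : Fin n → ℝ}
    (hlt : ∀ i, lo i < hi i)
    (hne : ∀ A : Finset (Fin n), ∑ i ∈ A, hi i + ∑ i ∈ Aᶜ, lo i ≠ 0)
    (hK : ∀ A : Finset (Fin n), A ∈ K ↔ ∑ i ∈ A, hi i + ∑ i ∈ Aᶜ, lo i < 0) :
    canonicalFan K = normalFan (boxSection lo hi) := by
  ext C
  constructor
  · rintro ⟨⟨A₁, A₂⟩, ⟨h₁, h₂, hd⟩, rfl⟩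
    have h₂' := (hne A₂ᶜ).symm.lt_of_le (not_lt.1 (mt (hK A₂ᶜ).2 h₂))
    rw [compl_compl] at h₂'
    obtain ⟨y, hy, rfl, rfl⟩ := exists_contactSet_eq hlt hd ((hK A₁).1 h₁) h₂'
    exact simplexCone_contactSet_mem_normalFan hlt hne hy
  · rintro ⟨F, hF, hFne, rfl⟩
    obtain ⟨y, hy, hC⟩ := normalCone_boxSection_of_isExposed hlt hne hF hFne
    refine ⟨(contactSet hi y, contactSet lo y), ⟨?_, ?_, disjoint_contactSet hlt y⟩, hC⟩
    · exact (hK _).2 ((sum_contactSet_nonpos hy).lt_of_ne (hne _))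
    · refine fun h => ((hK _).1 h).not_ge ?_
      rw [compl_compl]
      exact sum_compl_contactSet_nonneg hy

/-- The quota of a threshold complex can be chosen different from all weights of coalitions. -/
lemma exists_generic_quota {n : ℕ} (w : Fin n → ℝ) (q : ℝ) :
    ∃ q' : ℝ, ∀ A : Finset (Fin n), ∑ i ∈ A, w i ≠ q' ∧ (∑ i ∈ A, w i < q ↔ ∑ i ∈ A, w i < q') := by
  -- Lowering `q` slightly keeps the finitely many smaller sums below it and puts all others
  -- strictly above.
  have key : ∀ᶠ q' in nhdsWithin q (Set.Iio q), ∀ A : Finset (Fin n),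
      ∑ i ∈ A, w i ≠ q' ∧ (∑ i ∈ A, w i < q ↔ ∑ i ∈ A, w i < q') := by
    refine Filter.eventually_all.2 fun A => ?_
    by_cases h : ∑ i ∈ A, w i < q
    · filter_upwards [mem_nhdsWithin_of_mem_nhds (lt_mem_nhds h)] with q' hq'
      exact ⟨hq'.ne, iff_of_true h hq'⟩
    · filter_upwards [self_mem_nhdsWithin] with q' hq'
      have : q' < ∑ i ∈ A, w i := lt_of_lt_of_le hq' (not_lt.1 h)
      exact ⟨this.ne', iff_of_false h this.not_gt⟩
  exact key.exists

theorem isPolytopalFan_of_isThresholdComplex {n : ℕ} {K : Set (Finset (Fin n))}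
    (hempty : ∅ ∈ K) (huniv : Finset.univ ∉ K) (h : IsThresholdComplex K) :
    IsPolytopalFan (canonicalFan K) := by
  obtain ⟨w, q₀, hw, -, hKq⟩ := h
  obtain ⟨q, hq⟩ := exists_generic_quota w q₀
  have hmem : ∀ A, A ∈ K ↔ ∑ i ∈ A, w i < q := fun A => by rw [hKq]; exact (hq A).2
  have hn : (n : ℝ) ≠ 0 := by
    rintro hn
    obtain rfl := Nat.cast_eq_zero.1 hn
    exact huniv hempty
  -- The box `∏ [0, wᵢ]` is translated by `-q/n` in each coordinate, which carries the hyperplane `∑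
  -- xᵢ = q` to `H₀`.
  set lo : Fin n → ℝ := fun _ => -(q / n) with hlo
  set hi : Fin n → ℝ := fun i => w i - q / n with hhi
  have hsum : ∀ A : Finset (Fin n), ∑ i ∈ A, hi i + ∑ i ∈ Aᶜ, lo i = ∑ i ∈ A, w i - q := by
    intro A
    have h₁ := Finset.sum_add_sum_compl A fun _ => q / (n : ℝ)
    have h₂ : ∑ _i : Fin n, q / (n : ℝ) = q := by simp; field_simp
    simp only [hlo, hhi, Finset.sum_sub_distrib, Finset.sum_neg_distrib]
    linarith
  have hlt : ∀ i, lo i < hi i := fun i => by simp only [hlo, hhi]; linarith [hw i]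
  have hne : ∀ A : Finset (Fin n), ∑ i ∈ A, hi i + ∑ i ∈ Aᶜ, lo i ≠ 0 := fun A => by
    rw [hsum, sub_ne_zero]
    exact (hq A).1
  have hK : ∀ A : Finset (Fin n), A ∈ K ↔ ∑ i ∈ A, hi i + ∑ i ∈ Aᶜ, lo i < 0 := fun A => by
    rw [hsum, sub_neg, hmem]
  refine ⟨boxSection lo hi, isConvexPolytope_boxSection ?_,
    canonicalFan_eq_normalFan_boxSection hlt hne hK⟩
  have h₂ := (hne Finset.univ).symm.lt_of_le (not_lt.1 (mt (hK Finset.univ).2 huniv))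
  obtain ⟨y, hy, -⟩ := exists_contactSet_eq hlt (Finset.disjoint_empty_left ∅)
    ((hK ∅).1 hempty) (by simpa using h₂)
  exact ⟨y, hy⟩

/-! ### Weighted majority games -/

theorem isThresholdComplex_iff_isPositivelyWeightedMajorityGame_compl {n : ℕ}
    {K : Set (Finset (Fin n))} (hK : IsSimplicialComplex K) (huniv : Finset.univ ∉ K) :
    IsThresholdComplex K ↔ IsPositivelyWeightedMajorityGame Kᶜ := by
  constructor
  · rintro ⟨w, q, hw, -, hKq⟩
    refine ⟨⟨huniv, fun h => h hK.empty_mem, hK.isLowerSet.compl⟩, w, q, hw, fun A => ?_⟩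
    rw [hKq, Set.mem_compl_iff, Set.mem_ofPred_eq, not_lt]
  · rintro ⟨-, w, q, hw, h⟩
    have hmem : ∀ A, A ∈ K ↔ ∑ i ∈ A, w i < q := fun A => by
      rw [← not_le, ← h A, Set.mem_compl_iff, not_not]
    exact ⟨w, q, hw, by simpa using (hmem ∅).1 hK.empty_mem, Set.ext hmem⟩

theorem theorem1 {n : ℕ} (K : Set (Finset (Fin n)))
    (hK : IsSimplicialComplex K) (hproper : K ≠ Set.univ) (hvert : vertexSet K = Set.univ) :
    (IsThresholdComplex K ↔ IsPositivelyWeightedMajorityGame Kᶜ) ∧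
      (IsThresholdComplex K ↔ IsPolytopalFan (canonicalFan K)) := by
  have huniv : Finset.univ ∉ K := fun h =>
    hproper (Set.eq_univ_of_forall fun A => hK.isLowerSet (Finset.subset_univ A) h)
  exact ⟨isThresholdComplex_iff_isPositivelyWeightedMajorityGame_compl hK huniv,
    isPolytopalFan_of_isThresholdComplex hK.empty_mem huniv,
    isThresholdComplex_of_isPolytopalFan hK huniv⟩
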